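/- **Theorem (strong law for degrees in random $m$-ary hooking networks).** Let $G_0$ be a finite connected graph (the seed; loops, counted twice in degrees, and parallel edges are allowed) with $\tau_0\ge 2$ vertices, one of which is designated as the hook. Let $d_1<\dots<d_k$ be the distinct vertex degrees of $G_0$, let $n_j$ be the number of vertices of degree $d_j$ in $G_0$, and let $h=d_i$ be the degree of the hook. Fix an integer $m\ge 1$. The $m$-ary hooking network grows as follows. The network of age $0$ is $G_0$. Every vertex enters the network with $m$ insertion positions. At each step $n\ge1$ one of the unused insertion positions of the network of age $n-1$ is chosen uniformly at random, given the past, and is used up; the vertex it belongs to (the latch) is fused with the hook of a new copy of $G_0$. The vertices of this copy other than its hook are new, and each brings $m$ insertion positions. Let $D_{n,d_j+sh}$ be the number of vertices of the network of age $n$ whose original degree (their degree in the copy of $G_0$ with which they came) is $d_j$ and that have been a latch exactly $s$ times; these counts are indexed by the pairs $(j,s)$, $1\le j\le k$, $0\le s\le m$, even if some of the numbers $d_j+sh$ coincide. Let $\mathbf D_n=(\mathbf D_n^{(0)},\dots,\mathbf D_n^{(m)})$ with blocks $\mathbf D_n^{(s)}=(D_{n,d_1+sh},\dots,D_{n,d_k+sh})^T$.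 Let $\mathbf A$ be the $mk\times mk$ replacement matrix of the urn of insertion positions, where a position has colour $(s,j)$, $0\le s\le m-1$, $1\le j\le k$, if its vertex has original degree $d_j$ and has been a latch $s$ times: the entry of $\mathbf A$ in row $(s,j)$ and column $(s',j')$ is $$m(n_{j'}-\mathbf 1[j'=i])\,\mathbf 1[s'=0]-(m-s)\,\mathbf 1[s'=s,\,j'=j]+(m-s-1)\,\mathbf 1[s'=s+1,\,j'=j].$$ Suppose that the network is invertible, that is, that $\mathbf A^T$ is invertible. Write $(x)_r=x(x-1)\cdots(x-r+1)$, $\alpha_m=m\tau_0-m-1$ and $$\mathbf y_1=\frac{m}{m\tau_0-1}\,(n_1,\dots,n_{i-1},\,n_i-1,\,n_{i+1},\dots,n_k)^T .$$ Then $\frac1n\mathbf D_n$ converges almost surely, as $n\to\infty$, to the vector with blocks $$\frac{\alpha_m}{m-s}\,\frac{(m-1)_s}{(m\tau_0-2)_s}\,\mathbf y_1\quad(s=0,\dots,m-1),\qquad \frac{(m-1)_{m-1}}{(m\tau_0-2)_{m-1}}\,\mathbf y_1\quad(s=m).$$ -/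

import Mathlib

open MeasureTheory Filter Topology

namespace HookingNetwork

noncomputable section

/-- The degree of a vertex in a multigraph; a loop contributes two. -/
def deg {α β : Type*} (G : Graph α β) (v : α) : ℕ :=
  (G.incidenceSet v).ncard + (G.loopSet v).ncard

/-- A seed: a finite connected multigraph (parallel edges and loops are allowed)
with a distinguished vertex, the hook. -/
structure IsSeed {α β : Type*} (G : Graph α β) (hook : α) : Prop where
  finite_vertexSet : G.vertexSet.Finite
  finite_edgeSet : G.edgeSet.Finite
  hook_mem : hook ∈ G.vertexSet
  connected : ∀ u ∈ G.vertexSet, ∀ v ∈ G.vertexSet, Relation.ReflTransGen G.Adj u v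

/-- Where the vertex `v` of the `t`-th copy of the seed sits in the network. Copy `0` is the
initial network. Copy `t + 1` is adjoined at step `t + 1`: its hook is identified with the
vertex `latch t` of the existing network, its other vertices are new. -/
def place {α : Type*} (hook : α) (latch : ℕ → ℕ × α) : ℕ → α → ℕ × α
  | 0, v => (0, v)
  | t + 1, v => open Classical in if v = hook then latch t else (t + 1, v)

/-- The network of age `n`: the union of the copies `0, …, n` of the seed, with the hook of
copy `t + 1` fused into `latch t`. The vertex `(t, v)` is the vertex `v` that entered the network
with copy `t`, and `(t, e)` is the edge `e` of copy `t`. -/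
def network {α β : Type*} (G : Graph α β) (hook : α) (latch : ℕ → ℕ × α) (n : ℕ) :
    Graph (ℕ × α) (ℕ × β) where
  vertexSet := {y | ∃ t ≤ n, ∃ v ∈ G.vertexSet, place hook latch t v = y}
  IsLink e y z := e.1 ≤ n ∧ ∃ v w, G.IsLink e.2 v w ∧
    place hook latch e.1 v = y ∧ place hook latch e.1 w = z
  isLink_symm := by
    intro e _
    refine ⟨?_⟩
    rintro y z ⟨hn, v, w, h, hv, hw⟩
    exact ⟨hn, w, v, h.symm, hw, hv⟩
  eq_or_eq_of_isLink_of_isLink := by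
    rintro e x y v w ⟨-, a, b, h, rfl, rfl⟩ ⟨-, c, d, h', rfl, rfl⟩
    rcases h.left_eq_or_eq h' with rfl | rfl
    · exact Or.inl rfl
    · exact Or.inr rfl
  left_mem_of_isLink := by
    rintro e x y ⟨hn, a, b, h, rfl, rfl⟩
    exact ⟨e.1, hn, a, h.left_mem, rfl⟩

/-- An insertion position: a vertex of the network, and one of the `m` slots (virtual nodes)
that this vertex had when it entered the network. -/
abbrev Position (α : Type*) (m : ℕ) : Type _ := (ℕ × α) × Fin m

/-- The latches belonging to a sequence of chosen insertion positions. -/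
def latches {α : Type*} {m : ℕ} (q : ℕ → Position α m) : ℕ → ℕ × α := fun t => (q t).1

/-- The insertion positions available in the network of age `n`, when `q t` is the position used
at step `t + 1`: all slots at vertices of the network that have not been used. A vertex that has
recruited `r` times has `m - r` of them. -/
def available {α β : Type*} (G : Graph α β) (hook : α) {m : ℕ} (q : ℕ → Position α m) (n : ℕ) :
    Set (Position α m) :=
  {p | p.1 ∈ (network G hook (latches q) n).vertexSet ∧ ∀ t < n, q t ≠ p}

/-- The random growth of the `m`-ary hooking network: `p t` is the insertion position chosen at
step `t + 1`; given the history, it is uniformly distributed over the available positions. -/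
structure IsUniformGrowth {α β Ω : Type*} [MeasurableSpace Ω] (G : Graph α β) (hook : α)
    (m : ℕ) (μ : Measure Ω) (p : ℕ → Ω → Position α m) : Prop where
  measurableSet_eq : ∀ t q, MeasurableSet {ω | p t ω = q}
  mem_available : ∀ᵐ ω ∂μ, ∀ n, p n ω ∈ available G hook (fun t => p t ω) n
  uniform : ∀ (n : ℕ) (q : ℕ → Position α m), q n ∈ available G hook q n →
    μ {ω | ∀ t ≤ n, p t ω = q t} =
      μ {ω | ∀ t < n, p t ω = q t} / ((available G hook q n).ncard : ENNReal)

/-- The number of times the vertex `y` has been the latch in the first `n` steps. -/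
def timesLatched {α : Type*} (latch : ℕ → ℕ × α) (n : ℕ) (y : ℕ × α) : ℕ :=
  {t | t < n ∧ latch t = y}.ncard

/-- The number of vertices of the network of age `n` that have latched `s` times and whose
original degree, that is, their degree in the copy of the seed with which they came, is `d`. -/
def degreeCount {α β : Type*} (G : Graph α β) (hook : α) (latch : ℕ → ℕ × α)
    (n d s : ℕ) : ℕ :=
  {y ∈ (network G hook latch n).vertexSet |
    deg G y.2 = d ∧ timesLatched latch n y = s}.ncard

/-- The number of vertices of degree `d` in the seed. -/
def seedCount {α β : Type*} (G : Graph α β) (d : ℕ) : ℕ :=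
  {v ∈ G.vertexSet | deg G v = d}.ncard

/-- The replacement matrix of the urn of insertion positions. The colour `(s, j)` is carried by
the insertion positions at vertices of original degree `d j` that have latched `s` times, `c j` is
the number of vertices of degree `d j` in the seed, and `i` is the index of the degree of the hook.
Row `(s, j)` lists the changes when a position of colour `(s, j)` is chosen: the new copy of the
seed brings `m * c l` positions of each colour `(0, l)`, except that those of its hook are lost;
the `m - s` positions at the latch disappear and `m - s - 1` of colour `(s + 1, j)` appear. -/
def replacementMatrix (m k : ℕ) (c : Fin k → ℕ) (i : Fin k) :
    Matrix (Fin m × Fin k) (Fin m × Fin k) ℝ :=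
  Matrix.of fun a b =>
    (if (b.1 : ℕ) = 0 then (m : ℝ) * ((c b.2 : ℝ) - if b.2 = i then 1 else 0) else 0)
    - (if b = a then (m : ℝ) - (a.1 : ℝ) else 0)
    + (if (b.1 : ℕ) = a.1 + 1 ∧ b.2 = a.2 then (m : ℝ) - (a.1 : ℝ) - 1 else 0)

/-- The falling factorial `x (x - 1) ⋯ (x - r + 1)`. -/
def fallingFactorial (x : ℝ) (r : ℕ) : ℝ := ∏ l ∈ Finset.range r, (x - (l : ℝ))

/-- The vector `y₁ = m / (m τ₀ - 1) * (c 1, …, c i - 1, …, c k)`. -/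
def firstBlock (m τ₀ k : ℕ) (c : Fin k → ℕ) (i : Fin k) (j : Fin k) : ℝ :=
  (m : ℝ) / ((m : ℝ) * (τ₀ : ℝ) - 1) * ((c j : ℝ) - if j = i then 1 else 0)

/-- The limit of the scaled degree vector. Its block `s < m` is
`α_m / (m - s) * (m - 1)_s / (m τ₀ - 2)_s * y₁` with `α_m = m τ₀ - m - 1`, and its block `s = m` is
`(m - 1)_(m - 1) / (m τ₀ - 2)_(m - 1) * y₁`. -/
def limitVector (m τ₀ k : ℕ) (c : Fin k → ℕ) (i : Fin k) (s : Fin (m + 1)) (j : Fin k) : ℝ :=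
  if (s : ℕ) < m then
    ((m : ℝ) * (τ₀ : ℝ) - (m : ℝ) - 1) / ((m : ℝ) - (s : ℝ))
      * (fallingFactorial ((m : ℝ) - 1) s / fallingFactorial ((m : ℝ) * (τ₀ : ℝ) - 2) s)
      * firstBlock m τ₀ k c i j
  else
    fallingFactorial ((m : ℝ) - 1) (m - 1) / fallingFactorial ((m : ℝ) * (τ₀ : ℝ) - 2) (m - 1)
      * firstBlock m τ₀ k c i j

end

end HookingNetwork

/-! Fix an original degree `d j` and let the stage of a vertex be the number `s` of times it has
latched. Let `X s n` count the vertices of degree `d j` in stage `s` at age `n`, and `S s n` the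
latches among the first `n` that were such vertices when chosen. Each stage is a reservoir: `X 0 + S
0` grows by exactly `n_j - 1[j = i]` per step, and `X (s+1) + S (s+1)` differs from `S s` by a
constant. Given the past, the next latch leaves stage `s` with probability `(m - s) X s n / (m τ₀ +
α n)`, where `α = m τ₀ - m - 1`; the denominator, the number of available positions, is
deterministic. No spectral analysis of the urn is needed.

The indicators minus their conditional probabilities are bounded and pairwise orthogonal, so their
averages vanish almost surely (`ae_tendsto_average_centredIndicator`). The rest is deterministic:
inflow of slope `a` and outflow rate `r = m - s` force `X s n / n → a α / (α + r)`
(`tendsto_div_of_proportional_outflow`), and the outflow feeds the next stage. Induction on `s`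
(`tendsto_degreeCount_div`) reproduces the recursion `limitVector_succ`.

Positivity of `α` is essential: invertibility excludes `α = 0`, since all row sums equal `α`, and
with `α < 0` the positions would run out. -/

namespace HookingNetwork

/-! ### Deterministic stochastic approximation -/

/-- A recursion `z (n + 1) = (1 - γ n) z n + γ n δ n` with weights in `[0, 1]` and `δ n = o(n)`
started at `0` has `z n = o(n)`. -/
theorem tendsto_div_of_convex_recursion {z δ γ : ℕ → ℝ} (hγ0 : ∀ n, 0 ≤ γ n) (hγ1 : ∀ n, γ n ≤ 1)
    (hz0 : z 0 = 0) (hz : ∀ n, z (n + 1) = (1 - γ n) * z n + γ n * δ n)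
    (hδ : Tendsto (fun n : ℕ => δ n / n) atTop (𝓝 0)) :
    Tendsto (fun n : ℕ => z n / n) atTop (𝓝 0) := by
  rw [Metric.tendsto_atTop] at hδ ⊢
  intro ε hε
  obtain ⟨n₀, hn₀⟩ := hδ (ε / 2) (by positivity)
  set C : ℝ := ∑ t ∈ Finset.range (n₀ + 1), |δ t| with hC
  have hC0 : 0 ≤ C := Finset.sum_nonneg fun _ _ => abs_nonneg _
  -- `C` absorbs the early terms. An affine bound increasing in `n` survives convex combinations, so
  -- `z` inherits it.
  have hbound : ∀ n, |δ n| ≤ ε / 2 * n + C := by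
    intro n
    rcases lt_or_ge n (n₀ + 1) with h | h
    · have h1 : |δ n| ≤ C :=
        Finset.single_le_sum (f := fun t => |δ t|) (fun _ _ => abs_nonneg _)
          (Finset.mem_range.2 h)
      have : 0 ≤ ε / 2 * n := by positivity
      linarith
    · have h1 := hn₀ n (by omega)
      have hn : (0 : ℝ) < n := by exact_mod_cast (by omega : 0 < n)
      rw [Real.dist_eq, sub_zero, abs_div, abs_of_pos hn, div_lt_iff₀ hn] at h1
      linarith
  have hzb : ∀ n, |z n| ≤ ε / 2 * n + C := by
    intro n
    induction n with
    | zero => simpa [hz0] using hC0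
    | succ n ih =>
      rw [hz]
      have h1 : |(1 - γ n) * z n + γ n * δ n| ≤ (1 - γ n) * |z n| + γ n * |δ n| := by
        refine (abs_add_le _ _).trans ?_
        rw [abs_mul, abs_mul, abs_of_nonneg (hγ0 n), abs_of_nonneg (sub_nonneg.2 (hγ1 n))]
      have h2 := mul_le_mul_of_nonneg_left ih (sub_nonneg.2 (hγ1 n))
      have h3 := mul_le_mul_of_nonneg_left (hbound n) (hγ0 n)
      push_cast
      linarith
  obtain ⟨n₁, hn₁⟩ := exists_nat_gt (C / (ε / 2))
  refine ⟨n₁ + 1, fun n hn => ?_⟩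
  have hn0 : (0 : ℝ) < n := by exact_mod_cast (by omega : 0 < n)
  have hn1 : (n₁ : ℝ) < n := by exact_mod_cast (by omega : n₁ < n)
  rw [Real.dist_eq, sub_zero, abs_div, abs_of_pos hn0, div_lt_iff₀ hn0]
  have h1 : C < ε / 2 * n := by
    rw [div_lt_iff₀ (by positivity)] at hn₁
    nlinarith
  linarith [hzb n]

/-- Deterministic stochastic approximation: a quantity with linear inflow `a`, which flows out at
relative rate `r / (β + α n)` up to `o(n)`, grows linearly with slope `a α / (α + r)`. -/
theorem tendsto_div_of_proportional_outflow {α β a r : ℝ} (hα : 0 < α) (hβ : 0 < β) (hr : 0 ≤ r)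
    (hrβ : r ≤ β) {X S : ℕ → ℝ}
    (hXS : Tendsto (fun n : ℕ => (X n + S n) / n) atTop (𝓝 a))
    (hS : Tendsto (fun n : ℕ => (S n - ∑ t ∈ Finset.range n, r * X t / (β + α * t)) / n)
      atTop (𝓝 0)) :
    Tendsto (fun n : ℕ => X n / n) atTop (𝓝 (a * α / (α + r))) := by
  have hN : ∀ n : ℕ, 0 < β + α * n := fun n => by positivity
  -- The balance of slopes is `c + r c / α = a`: growth of the stock plus growth of the outflow
  -- equals the inflow.
  set c := a * α / (α + r) with hc
  set γ : ℕ → ℝ := fun n => r / (β + α * n) with hγ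
  set z : ℕ → ℝ := fun n => ∑ t ∈ Finset.range n, γ t * (X t - c * t) with hz
  -- Since `X n - c n = δ n - z n`, the sums `z` satisfy the convex recursion driven by `δ`, and the
  -- balance of slopes makes `δ n = o(n)`.
  set δ : ℕ → ℝ := fun n => X n - c * n + z n with hδ
  have hces : Tendsto (fun n : ℕ => (n : ℝ)⁻¹ * ∑ t ∈ Finset.range n, γ t * (c * t)) atTop
      (𝓝 (r * c / α)) := by
    refine Tendsto.cesaro ?_
    have h0 : Tendsto (fun n : ℕ => β / (n : ℝ)) atTop (𝓝 0) :=
      tendsto_const_div_atTop_nhds_zero_nat β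
    have h1 : Tendsto (fun n : ℕ => r * c / (β / (n : ℝ) + α)) atTop (𝓝 (r * c / (0 + α))) :=
      tendsto_const_nhds.div (h0.add_const α) (by simpa using hα.ne')
    rw [zero_add] at h1
    refine h1.congr' ?_
    filter_upwards [eventually_gt_atTop 0] with n hn
    have hn' : (n : ℝ) ≠ 0 := by exact_mod_cast hn.ne'
    have := (hN n).ne'
    have h2 : β / (n : ℝ) + α = (β + α * n) / n := by field_simp
    rw [h2]
    simp only [hγ]
    field_simp
  have hδlim : Tendsto (fun n : ℕ => δ n / n) atTop (𝓝 0) := by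
    have h := ((hXS.sub hS).sub_const c).sub hces
    have hval : a - 0 - c - r * c / α = 0 := by
      rw [hc]; field_simp; ring
    rw [hval] at h
    refine h.congr' ?_
    filter_upwards [eventually_gt_atTop 0] with n hn
    have hn' : (n : ℝ) ≠ 0 := by exact_mod_cast hn.ne'
    have h1 : z n = ∑ t ∈ Finset.range n, r * X t / (β + α * t)
        - ∑ t ∈ Finset.range n, γ t * (c * t) := by
      rw [hz, ← Finset.sum_sub_distrib]
      refine Finset.sum_congr rfl fun t _ => ?_
      simp only [hγ]
      ring
    simp only [hδ, h1]
    field_simp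
    ring
  have hzlim : Tendsto (fun n : ℕ => z n / n) atTop (𝓝 0) := by
    refine tendsto_div_of_convex_recursion (γ := γ) (δ := δ) (fun n => ?_) (fun n => ?_) ?_
      (fun n => ?_) hδlim
    · exact div_nonneg hr (hN n).le
    · refine (div_le_one (hN n)).2 ?_
      have : 0 ≤ α * n := by positivity
      linarith
    · simp [hz]
    · simp only [hδ]
      rw [show z (n + 1) = z n + γ n * (X n - c * n) from Finset.sum_range_succ _ _]
      ring
  have h := (hδlim.sub hzlim).add_const c
  rw [sub_zero, zero_add] at h
  refine h.congr' ?_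
  filter_upwards [eventually_gt_atTop 0] with n hn
  have hn' : (n : ℝ) ≠ 0 := by exact_mod_cast hn.ne'
  simp only [hδ]
  field_simp
  ring

/-! ### Strong law for bounded orthogonal variables -/

/-- Convergence of averages along the squares implies convergence of averages, for partial sums
of a sequence bounded by `1`. -/
theorem tendsto_average_of_tendsto_squares {x : ℕ → ℝ} (hx : ∀ n, |x n| ≤ 1)
    (h : Tendsto (fun n : ℕ => (∑ t ∈ Finset.range (n ^ 2), x t) / (n : ℝ) ^ 2) atTop (𝓝 0)) :
    Tendsto (fun n : ℕ => (∑ t ∈ Finset.range n, x t) / n) atTop (𝓝 0) := by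
  have hsqrt : Tendsto Nat.sqrt atTop atTop := by
    refine tendsto_atTop.2 fun b => ?_
    filter_upwards [eventually_ge_atTop (b * b)] with n hn
    exact Nat.le_sqrt.2 hn
  have h1 : Tendsto (fun n : ℕ => |(∑ t ∈ Finset.range (n ^ 2), x t) / (n : ℝ) ^ 2| + 2 / (n : ℝ))
      atTop (𝓝 0) := by
    have := h.abs.add (tendsto_const_div_atTop_nhds_zero_nat (2 : ℝ))
    simpa using this
  refine squeeze_zero_norm' ?_ (h1.comp hsqrt)
  filter_upwards [eventually_gt_atTop 0] with n hn
  have hk : 0 < n.sqrt := Nat.sqrt_pos.2 hn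
  -- As `k ^ 2 ≤ n ≤ k ^ 2 + 2 k`, the terms beyond `k ^ 2` contribute at most `2 k`, which is `2 /
  -- k` after division by `k ^ 2`.
  set k := n.sqrt with hkdef
  have hk2 : k ^ 2 ≤ n := by rw [pow_two]; exact Nat.sqrt_le n
  have hn2 : n ≤ k ^ 2 + 2 * k := by
    have := Nat.sqrt_le_add n
    rw [← hkdef] at this
    nlinarith
  have hk' : (0 : ℝ) < k := by exact_mod_cast hk
  have hk2' : (k : ℝ) ^ 2 ≤ n := by exact_mod_cast hk2
  have hn2' : (n : ℝ) - (k : ℝ) ^ 2 ≤ 2 * k := by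
    have : (n : ℝ) ≤ (k : ℝ) ^ 2 + 2 * k := by exact_mod_cast hn2
    linarith
  have hn' : (0 : ℝ) < n := by exact_mod_cast hn
  have hdiff : |∑ t ∈ Finset.range n, x t - ∑ t ∈ Finset.range (k ^ 2), x t| ≤ 2 * k := by
    rw [← Finset.sum_Ico_eq_sub _ hk2]
    refine (Finset.abs_sum_le_sum_abs _ _).trans ?_
    refine (Finset.sum_le_sum fun t _ => hx t).trans ?_
    simp only [Finset.sum_const, Nat.card_Ico, nsmul_eq_mul, mul_one]
    rw [Nat.cast_sub hk2]
    push_cast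
    exact hn2'
  simp only [Function.comp_apply, Real.norm_eq_abs, ← hkdef]
  rw [abs_div, abs_of_pos hn', abs_div, abs_of_pos (pow_pos hk' 2)]
  have h3 : |∑ t ∈ Finset.range n, x t| ≤ |∑ t ∈ Finset.range (k ^ 2), x t| + 2 * k := by
    have := abs_sub_abs_le_abs_sub (∑ t ∈ Finset.range n, x t) (∑ t ∈ Finset.range (k ^ 2), x t)
    linarith
  calc |∑ t ∈ Finset.range n, x t| / (n : ℝ)
      ≤ (|∑ t ∈ Finset.range (k ^ 2), x t| + 2 * k) / (k : ℝ) ^ 2 := by gcongr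
    _ = _ := by field_simp

/-- Strong law of large numbers for uniformly bounded, pairwise orthogonal random variables. -/
theorem ae_tendsto_average_of_orthogonal {Ω : Type*} [MeasurableSpace Ω] {μ : Measure Ω}
    [IsProbabilityMeasure μ] {ξ : ℕ → Ω → ℝ} (hξ : ∀ n, AEStronglyMeasurable (ξ n) μ)
    (hbd : ∀ n ω, |ξ n ω| ≤ 1) (horth : ∀ s t, s < t → ∫ ω, ξ s ω * ξ t ω ∂μ = 0) :
    ∀ᵐ ω ∂μ, Tendsto (fun n : ℕ => (∑ t ∈ Finset.range n, ξ t ω) / n) atTop (𝓝 0) := by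
  have hmul : ∀ s t, Integrable (fun ω => ξ s ω * ξ t ω) μ := fun s t => by
    refine Integrable.of_bound ((hξ s).mul (hξ t)) 1 (ae_of_all _ fun ω => ?_)
    rw [norm_mul, Real.norm_eq_abs, Real.norm_eq_abs]
    exact mul_le_one₀ (hbd s ω) (abs_nonneg _) (hbd t ω)
  have horth' : ∀ s t, s ≠ t → ∫ ω, ξ s ω * ξ t ω ∂μ = 0 := fun s t hst => by
    rcases lt_or_gt_of_ne hst with h | h
    · exact horth s t h
    · simpa only [mul_comm] using horth t s h
  have hdiag : ∀ s, ∫ ω, ξ s ω * ξ s ω ∂μ ≤ 1 := fun s => by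
    calc ∫ ω, ξ s ω * ξ s ω ∂μ ≤ ∫ _, (1 : ℝ) ∂μ := by
          refine integral_mono (hmul s s) (integrable_const _) fun ω => ?_
          have := hbd s ω
          simp only
          rw [← abs_mul_abs_self]
          exact mul_le_one₀ this (abs_nonneg _) this
      _ = 1 := by simp
  set M : ℕ → Ω → ℝ := fun n ω => ∑ t ∈ Finset.range n, ξ t ω with hM
  have hsq : ∀ n ω, M n ω ^ 2 = ∑ s ∈ Finset.range n, ∑ t ∈ Finset.range n, ξ s ω * ξ t ω :=
    fun n ω => by rw [hM, pow_two, Finset.sum_mul_sum]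
  have hMint : ∀ n, Integrable (fun ω => M n ω ^ 2) μ := fun n => by
    simp only [hsq]
    exact integrable_finsetSum _ fun s _ => integrable_finsetSum _ fun t _ => hmul s t
  have hM2 : ∀ n : ℕ, ∫ ω, M n ω ^ 2 ∂μ ≤ n := fun n => by
    simp only [hsq]
    rw [integral_finsetSum _ fun s _ => integrable_finsetSum _ fun t _ => hmul s t]
    calc _ ≤ ∑ s ∈ Finset.range n, (1 : ℝ) := by
          refine Finset.sum_le_sum fun s hs => ?_
          rw [integral_finsetSum _ fun t _ => hmul s t,
            Finset.sum_eq_single_of_mem s hs fun t _ hts => horth' s t hts.symm]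
          exact hdiag s
      _ = n := by simp
  -- Orthogonality bounds the second moment of the average of `N` terms by `1 / N`, which is
  -- summable along `N = n ^ 2`; hence the squared averages have an almost surely finite sum.
  set F : ℕ → Ω → ENNReal := fun n ω => ENNReal.ofReal ((M (n ^ 2) ω / (n : ℝ) ^ 2) ^ 2) with hF
  have hFint : ∀ n : ℕ, Integrable (fun ω => (M (n ^ 2) ω / (n : ℝ) ^ 2) ^ 2) μ := fun n => by
    simp only [div_pow]
    exact (hMint _).div_const _
  have hFmeas : ∀ n, AEMeasurable (F n) μ := fun n => (hFint n).aemeasurable.ennreal_ofReal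
  have hFle : ∀ n : ℕ, ∫⁻ ω, F n ω ∂μ ≤ ENNReal.ofReal (1 / (n : ℝ) ^ 2) := fun n => by
    rw [hF, ← ofReal_integral_eq_lintegral_ofReal (hFint n) (ae_of_all _ fun ω => sq_nonneg _)]
    refine ENNReal.ofReal_le_ofReal ?_
    simp only [div_pow]
    rw [integral_div]
    rcases Nat.eq_zero_or_pos n with rfl | hn
    · simp
    have hn' : (0 : ℝ) < n := by exact_mod_cast hn
    have := hM2 (n ^ 2)
    push_cast at this
    calc _ ≤ (n : ℝ) ^ 2 / ((n : ℝ) ^ 2) ^ 2 := by gcongr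
      _ = _ := by field_simp
  have hsum : ∫⁻ ω, ∑' n, F n ω ∂μ ≠ ⊤ := by
    rw [lintegral_tsum hFmeas]
    refine ne_top_of_le_ne_top ?_ (ENNReal.tsum_le_tsum hFle)
    have hs : Summable fun n : ℕ => 1 / (n : ℝ) ^ 2 :=
      Real.summable_one_div_nat_pow.2 one_lt_two
    rw [← ENNReal.ofReal_tsum_of_nonneg (fun n => by positivity) hs]
    exact ENNReal.ofReal_ne_top
  filter_upwards [ae_lt_top' (AEMeasurable.tsum hFmeas) hsum] with ω hω
  refine tendsto_average_of_tendsto_squares (fun n => hbd n ω) ?_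
  have h0 := ENNReal.tendsto_atTop_zero_of_tsum_ne_top hω.ne
  have h1 : Tendsto (fun n : ℕ => (M (n ^ 2) ω / (n : ℝ) ^ 2) ^ 2) atTop (𝓝 0) := by
    have := (ENNReal.tendsto_toReal ENNReal.zero_ne_top).comp h0
    simpa [hF, Function.comp_def, ENNReal.toReal_ofReal (sq_nonneg _)] using this
  have h2 := h1.sqrt
  simp only [Real.sqrt_sq_eq_abs, Real.sqrt_zero] at h2
  exact (tendsto_zero_iff_abs_tendsto_zero _).2 h2

/-! ### Combinatorics of the growth along a fixed path -/

section Growth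

variable {α β : Type*} {G : Graph α β} {hook : α} {m : ℕ}

theorem network_vertexSet_zero (latch : ℕ → ℕ × α) :
    (network G hook latch 0).vertexSet = Prod.mk 0 '' G.vertexSet := by
  ext y
  simp [network, place]

/-- This and the other congruence lemmas express predictability: the state at age `n` depends only
on the choices before `n`. -/
theorem network_vertexSet_congr {latch latch' : ℕ → ℕ × α} {n : ℕ}
    (h : ∀ t < n, latch t = latch' t) :
    (network G hook latch n).vertexSet = (network G hook latch' n).vertexSet := by
  have hp : ∀ t ≤ n, ∀ v, place hook latch t v = place hook latch' t v := by
    rintro (_ | t) ht v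
    · rfl
    · simp only [place, h t ht]
  ext y
  simp only [network, Set.mem_ofPred_eq]
  constructor
  · rintro ⟨t, ht, v, hv, rfl⟩
    exact ⟨t, ht, v, hv, (hp t ht v).symm⟩
  · rintro ⟨t, ht, v, hv, rfl⟩
    exact ⟨t, ht, v, hv, hp t ht v⟩

theorem timesLatched_congr {latch latch' : ℕ → ℕ × α} {n : ℕ}
    (h : ∀ t < n, latch t = latch' t) (y : ℕ × α) :
    timesLatched latch n y = timesLatched latch' n y := by
  unfold timesLatched
  congr 1
  ext t
  simp only [Set.mem_ofPred_eq]
  exact and_congr_right fun ht => by rw [h t ht]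

theorem available_congr {q q' : ℕ → Position α m} {n : ℕ} (h : ∀ t < n, q t = q' t) :
    available G hook q n = available G hook q' n := by
  have hl : ∀ t < n, latches q t = latches q' t := fun t ht => by simp [latches, h t ht]
  ext x
  simp only [available, Set.mem_ofPred_eq, network_vertexSet_congr hl]
  exact and_congr_right fun _ => forall₂_congr fun t ht => by rw [h t ht]

theorem network_vertexSet_succ {latch : ℕ → ℕ × α} {n : ℕ}
    (hl : latch n ∈ (network G hook latch n).vertexSet) :
    (network G hook latch (n + 1)).vertexSet =
      (network G hook latch n).vertexSet ∪ Prod.mk (n + 1) '' (G.vertexSet \ {hook}) := by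
  ext y
  constructor
  · rintro ⟨t, ht, v, hv, rfl⟩
    rcases Nat.lt_or_ge t (n + 1) with h | h
    · exact Or.inl ⟨t, by omega, v, hv, rfl⟩
    · obtain rfl : t = n + 1 := by omega
      by_cases hvh : v = hook
      · left
        simpa only [place, if_pos hvh] using hl
      · right
        exact ⟨v, ⟨hv, hvh⟩, by simp only [place, if_neg hvh]⟩
  · rintro (⟨t, ht, v, hv, rfl⟩ | ⟨v, ⟨hv, hvh⟩, rfl⟩)
    · exact ⟨t, by omega, v, hv, rfl⟩
    · exact ⟨n + 1, le_rfl, v, hv, by simp only [place, if_neg (show v ≠ hook from hvh)]⟩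

open Classical in
theorem timesLatched_succ (latch : ℕ → ℕ × α) (n : ℕ) (y : ℕ × α) :
    timesLatched latch (n + 1) y = timesLatched latch n y + if latch n = y then 1 else 0 := by
  unfold timesLatched
  have hfin : {t | t < n ∧ latch t = y}.Finite := (Set.finite_lt_nat n).subset fun t ht => ht.1
  split_ifs with h
  · rw [← Set.ncard_insert_of_notMem (a := n) (by simp) hfin]
    congr 1
    ext t
    simp only [Set.mem_ofPred_eq, Set.mem_insert_iff]
    constructor
    · rintro ⟨h1, h2⟩
      rcases Nat.lt_succ_iff_lt_or_eq.1 h1 with h3 | h3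
      · exact Or.inr ⟨h3, h2⟩
      · exact Or.inl h3
    · rintro (rfl | ⟨h1, h2⟩)
      · exact ⟨by omega, h⟩
      · exact ⟨by omega, h2⟩
  · rw [add_zero]
    congr 1
    ext t
    simp only [Set.mem_ofPred_eq]
    refine ⟨fun ⟨h1, h2⟩ => ⟨?_, h2⟩, fun ⟨h1, h2⟩ => ⟨by omega, h2⟩⟩
    rcases Nat.lt_succ_iff_lt_or_eq.1 h1 with h3 | rfl
    · exact h3
    · exact absurd h2 h

/-- The vertices of original degree `d` that have latched `s` times. -/
def degreeClass (G : Graph α β) (hook : α) (latch : ℕ → ℕ × α) (n d s : ℕ) : Set (ℕ × α) :=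
  {y ∈ (network G hook latch n).vertexSet | deg G y.2 = d ∧ timesLatched latch n y = s}

/-- The insertion positions at vertices of original degree `d` that have latched `s` times. -/
def colourClass (G : Graph α β) (q : ℕ → Position α m) (n d s : ℕ) : Set (Position α m) :=
  {x | deg G x.1.2 = d ∧ timesLatched (latches q) n x.1 = s}

theorem colourClass_congr {q q' : ℕ → Position α m} {n : ℕ} (h : ∀ t < n, q t = q' t) (d s : ℕ) :
    colourClass G q n d s = colourClass G q' n d s := by
  have hl : ∀ t < n, latches q t = latches q' t := fun t ht => by simp [latches, h t ht]
  ext x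
  simp only [colourClass, Set.mem_ofPred_eq, timesLatched_congr hl]

variable {q : ℕ → Position α m}

theorem latches_mem (hq : ∀ n, q n ∈ available G hook q n) (n : ℕ) :
    latches q n ∈ (network G hook (latches q) n).vertexSet := (hq n).1

theorem injective_of_mem_available (hq : ∀ n, q n ∈ available G hook q n) :
    Function.Injective q := by
  intro s t hst
  rcases lt_trichotomy s t with h | h | h
  · exact absurd hst ((hq t).2 s h)
  · exact h
  · exact absurd hst.symm ((hq s).2 t h)

theorem network_vertexSet_subset (hq : ∀ n, q n ∈ available G hook q n)
    (n : ℕ) : (network G hook (latches q) n).vertexSet ⊆ Set.Iic n ×ˢ G.vertexSet := by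
  induction n with
  | zero =>
    rw [network_vertexSet_zero]
    rintro _ ⟨v, hv, rfl⟩
    exact ⟨Set.mem_Iic.2 le_rfl, hv⟩
  | succ n ih =>
    rw [network_vertexSet_succ (latches_mem hq n)]
    rintro y (hy | ⟨v, hv, rfl⟩)
    · exact ⟨(ih hy).1.trans (Nat.le_succ n), (ih hy).2⟩
    · exact ⟨Set.mem_Iic.2 le_rfl, hv.1⟩

theorem finite_network_vertexSet (hG : IsSeed G hook) (hq : ∀ n, q n ∈ available G hook q n)
    (n : ℕ) : (network G hook (latches q) n).vertexSet.Finite :=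
  ((Set.finite_Iic n).prod hG.finite_vertexSet).subset (network_vertexSet_subset hq n)

theorem disjoint_network_new (hq : ∀ n, q n ∈ available G hook q n) (n : ℕ) :
    Disjoint (network G hook (latches q) n).vertexSet
      (Prod.mk (n + 1) '' (G.vertexSet \ {hook})) := by
  rw [Set.disjoint_left]
  rintro _ hy ⟨v, -, rfl⟩
  have : n + 1 ≤ n := (network_vertexSet_subset hq n hy).1
  omega

/-- The latch with index `t` lies in the network of age `t`, so its copy number is at most `t < n`.
-/
theorem timesLatched_eq_zero_of_lt (hq : ∀ n, q n ∈ available G hook q n)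
    {n : ℕ} {y : ℕ × α} (hy : n ≤ y.1) (hpos : 0 < y.1) :
    timesLatched (latches q) n y = 0 := by
  unfold timesLatched
  rw [Set.ncard_eq_zero ((Set.finite_lt_nat n).subset fun t ht => ht.1)]
  ext t
  simp only [Set.mem_ofPred_eq, Set.mem_empty_iff_false, iff_false, not_and]
  rintro ht rfl
  have : (latches q t).1 ≤ t := (network_vertexSet_subset hq t (latches_mem hq t)).1
  omega

theorem ncard_network_vertexSet (hG : IsSeed G hook) (hq : ∀ n, q n ∈ available G hook q n)
    (n : ℕ) : ((network G hook (latches q) n).vertexSet.ncard : ℝ) =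
      G.vertexSet.ncard + n * ((G.vertexSet.ncard : ℝ) - 1) := by
  induction n with
  | zero =>
    rw [network_vertexSet_zero, Set.ncard_image_of_injective _ (Prod.mk_right_injective 0)]
    simp
  | succ n ih =>
    have h1 : ((G.vertexSet \ {hook}).ncard : ℝ) = (G.vertexSet.ncard : ℝ) - 1 := by
      rw [← Set.ncard_sdiff_singleton_add_one hG.hook_mem hG.finite_vertexSet]
      push_cast
      ring
    rw [network_vertexSet_succ (latches_mem hq n),
      Set.ncard_union_eq (disjoint_network_new hq n) (finite_network_vertexSet hG hq n)
        (hG.finite_vertexSet.sdiff.image _),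
      Set.ncard_image_of_injective _ (Prod.mk_right_injective _)]
    push_cast
    rw [ih, h1]
    ring

theorem available_eq_diff (n : ℕ) :
    available G hook q n =
      ((network G hook (latches q) n).vertexSet ×ˢ Set.univ) \ (q '' Set.Iio n) := by
  ext x
  simp [available]

theorem finite_available (hG : IsSeed G hook) (hq : ∀ n, q n ∈ available G hook q n) (n : ℕ) :
    (available G hook q n).Finite := by
  rw [available_eq_diff]
  exact ((finite_network_vertexSet hG hq n).prod Set.finite_univ).sdiff

/-- The `n` used positions are distinct slots of the network, so they are subtracted from `m` times
the number of vertices. Only admissibility of the path enters: the count is not random. -/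
theorem ncard_available (hG : IsSeed G hook) (hq : ∀ n, q n ∈ available G hook q n) (n : ℕ) :
    ((available G hook q n).ncard : ℝ) =
      m * G.vertexSet.ncard + (m * G.vertexSet.ncard - m - 1) * n := by
  have hfin := (finite_network_vertexSet hG hq n).prod (Set.finite_univ (α := Fin m))
  have hmono : Monotone fun t => (network G hook (latches q) t).vertexSet :=
    monotone_nat_of_le_succ fun t => by
      rw [network_vertexSet_succ (latches_mem hq t)]
      exact Set.subset_union_left
  have hsub : q '' Set.Iio n ⊆ (network G hook (latches q) n).vertexSet ×ˢ Set.univ := by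
    rintro _ ⟨t, ht, rfl⟩
    exact ⟨hmono (le_of_lt ht) (latches_mem hq t), trivial⟩
  have h1 := Set.ncard_sdiff_add_ncard_of_subset hsub hfin
  rw [← available_eq_diff, Set.ncard_prod, Set.ncard_univ, Nat.card_fin,
    Set.ncard_image_of_injective _ (injective_of_mem_available hq)] at h1
  have h2 : (Set.Iio n).ncard = n := by
    rw [← Nat.card_coe_set_eq]; simp
  rw [h2] at h1
  have h3 : ((available G hook q n).ncard : ℝ) + n =
      (network G hook (latches q) n).vertexSet.ncard * m := by exact_mod_cast h1
  rw [ncard_network_vertexSet hG hq] at h3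
  linear_combination h3

/-- A vertex that has latched `r` times has `m - r` unused slots. -/
theorem ncard_unused_slots (hq : ∀ n, q n ∈ available G hook q n) (n : ℕ) (y : ℕ × α) :
    {a : Fin m | ∀ t < n, q t ≠ (y, a)}.ncard + timesLatched (latches q) n y = m := by
  have himg : (fun t => (q t).2) '' {t | t < n ∧ latches q t = y} =
      {a : Fin m | ∀ t < n, q t ≠ (y, a)}ᶜ := by
    ext a
    simp only [Set.mem_image, Set.mem_ofPred_eq, Set.mem_compl_iff, not_forall, not_not, latches]
    constructor
    · rintro ⟨t, ⟨ht, rfl⟩, rfl⟩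
      exact ⟨t, ht, rfl⟩
    · rintro ⟨t, ht, h⟩
      exact ⟨t, ⟨ht, by rw [h]⟩, by rw [h]⟩
  have hinj : Set.InjOn (fun t => (q t).2) {t | t < n ∧ latches q t = y} := by
    rintro s ⟨-, hs⟩ t ⟨-, ht⟩ hst
    exact injective_of_mem_available hq (Prod.ext (hs.trans ht.symm) hst)
  have h := Set.ncard_add_ncard_compl {a : Fin m | ∀ t < n, q t ≠ (y, a)}
  rw [← himg, hinj.ncard_image, Nat.card_fin] at h
  exact h

/-- Divided by `ncard_available`, this makes the conditional probability of a colour linear in the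
degree count. For `s > m` the class is empty, so the negative factor is harmless. -/
theorem ncard_colourClass_inter_available (hG : IsSeed G hook)
    (hq : ∀ n, q n ∈ available G hook q n) (n d s : ℕ) :
    ((colourClass G q n d s ∩ available G hook q n).ncard : ℝ) =
      ((m : ℝ) - s) * degreeCount G hook (latches q) n d s := by
  classical
  have hfin : (degreeClass G hook (latches q) n d s).Finite :=
    (finite_network_vertexSet hG hq n).subset fun y hy => hy.1
  have hset : colourClass G q n d s ∩ available G hook q n =
      ((hfin.toFinset ×ˢ (Finset.univ : Finset (Fin m))).filter
        fun x => ∀ t < n, q t ≠ x : Finset (Position α m)) := by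
    ext x
    simp only [colourClass, available, degreeClass, Set.mem_inter_iff, Set.mem_ofPred_eq,
      Finset.coe_filter, Finset.mem_product, Set.Finite.mem_toFinset, Finset.mem_univ, and_true]
    tauto
  rw [hset, Set.ncard_coe_finset, Finset.card_filter, Finset.sum_product]
  push_cast
  have hslot : ∀ y ∈ hfin.toFinset,
      ∑ a : Fin m, (if ∀ t < n, q t ≠ (y, a) then (1 : ℝ) else 0) = (m : ℝ) - s := by
    intro y hy
    have h1 := ncard_unused_slots hq n y
    have h2 : timesLatched (latches q) n y = s := ((hfin.mem_toFinset).1 hy).2.2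
    rw [h2, Set.ncard_eq_toFinset_card'] at h1
    rw [← Finset.sum_filter, Finset.sum_const, nsmul_eq_mul, mul_one, eq_sub_iff_add_eq]
    have h3 : {a : Fin m | ∀ t < n, q t ≠ (y, a)}.toFinset =
        Finset.univ.filter fun a : Fin m => ∀ t < n, q t ≠ (y, a) := by
      ext a; simp
    rw [h3] at h1
    exact_mod_cast h1
  rw [Finset.sum_congr rfl hslot, Finset.sum_const, nsmul_eq_mul, mul_comm]
  congr 2
  rw [← Set.ncard_eq_toFinset_card _ hfin]
  rfl

open Classical in
theorem degreeCount_eq_sum (hG : IsSeed G hook) (hq : ∀ n, q n ∈ available G hook q n)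
    (n d s : ℕ) : (degreeCount G hook (latches q) n d s : ℝ) =
      ∑ y ∈ (finite_network_vertexSet hG hq n).toFinset,
        if deg G y.2 = d ∧ timesLatched (latches q) n y = s then (1 : ℝ) else 0 := by
  rw [← Finset.sum_filter, Finset.sum_const, nsmul_eq_mul, mul_one, ← Set.ncard_coe_finset]
  simp [degreeCount, Set.ofPred_and]

open Classical in
/-- One step of the growth: new vertices that have not latched appear, and the chosen latch is
moved from its class to the next. -/
theorem degreeCount_succ (hG : IsSeed G hook) (hq : ∀ n, q n ∈ available G hook q n)
    (n d s : ℕ) : (degreeCount G hook (latches q) (n + 1) d s : ℝ) =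
      degreeCount G hook (latches q) n d s
      + (if s = 0 then (seedCount G d : ℝ) - (if deg G hook = d then 1 else 0) else 0)
      + (if deg G (q n).1.2 = d ∧ timesLatched (latches q) n (q n).1 + 1 = s then 1 else 0)
      - (if q n ∈ colourClass G q n d s then 1 else 0) := by
  have hnewfin : (Prod.mk (n + 1) '' (G.vertexSet \ {hook})).Finite :=
    hG.finite_vertexSet.sdiff.image _
  have hunion : (finite_network_vertexSet hG hq (n + 1)).toFinset =
      (finite_network_vertexSet hG hq n).toFinset ∪ hnewfin.toFinset := by
    ext y
    simp only [Set.Finite.mem_toFinset, Finset.mem_union,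
      network_vertexSet_succ (latches_mem hq n), Set.mem_union]
  have hdisj : Disjoint (finite_network_vertexSet hG hq n).toFinset hnewfin.toFinset := by
    rw [Set.Finite.disjoint_toFinset]
    exact disjoint_network_new hq n
  have hnew : ∑ y ∈ hnewfin.toFinset,
      (if deg G y.2 = d ∧ timesLatched (latches q) (n + 1) y = s then (1 : ℝ) else 0) =
      if s = 0 then (seedCount G d : ℝ) - (if deg G hook = d then 1 else 0) else 0 := by
    have hzero : ∀ y ∈ hnewfin.toFinset, timesLatched (latches q) (n + 1) y = 0 := by
      intro y hy
      obtain ⟨v, -, rfl⟩ := (hnewfin.mem_toFinset).1 hy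
      exact timesLatched_eq_zero_of_lt hq le_rfl (Nat.succ_pos n)
    split_ifs with hs hd
    · rw [← Finset.sum_filter, Finset.sum_const, nsmul_eq_mul, mul_one, ← Set.ncard_coe_finset]
      have h1 : ((hnewfin.toFinset.filter fun y => deg G y.2 = d ∧
          timesLatched (latches q) (n + 1) y = s : Finset _) : Set (ℕ × α)) =
          Prod.mk (n + 1) '' ({v ∈ G.vertexSet | deg G v = d} \ {hook}) := by
        ext y
        simp only [Finset.coe_filter, Set.mem_ofPred_eq]
        constructor
        · rintro ⟨hy, h2, -⟩
          obtain ⟨v, hv, rfl⟩ := (hnewfin.mem_toFinset).1 hy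
          exact ⟨v, ⟨⟨hv.1, h2⟩, hv.2⟩, rfl⟩
        · rintro ⟨v, ⟨⟨hv, h2⟩, h3⟩, rfl⟩
          have hmem : (n + 1, v) ∈ hnewfin.toFinset :=
            (hnewfin.mem_toFinset).2 ⟨v, ⟨hv, h3⟩, rfl⟩
          exact ⟨hmem, h2, (hzero _ hmem).trans hs.symm⟩
      rw [h1, Set.ncard_image_of_injective _ (Prod.mk_right_injective _), seedCount,
        ← Set.ncard_sdiff_singleton_add_one (a := hook) (s := {v ∈ G.vertexSet | deg G v = d})
          ⟨hG.hook_mem, hd⟩ (hG.finite_vertexSet.subset fun v hv => hv.1)]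
      push_cast
      ring
    · rw [← Finset.sum_filter, Finset.sum_const, nsmul_eq_mul, mul_one, ← Set.ncard_coe_finset]
      have h1 : ((hnewfin.toFinset.filter fun y => deg G y.2 = d ∧
          timesLatched (latches q) (n + 1) y = s : Finset _) : Set (ℕ × α)) =
          Prod.mk (n + 1) '' {v ∈ G.vertexSet | deg G v = d} := by
        ext y
        simp only [Finset.coe_filter, Set.mem_ofPred_eq]
        constructor
        · rintro ⟨hy, h2, -⟩
          obtain ⟨v, hv, rfl⟩ := (hnewfin.mem_toFinset).1 hy
          exact ⟨v, ⟨hv.1, h2⟩, rfl⟩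
        · rintro ⟨v, ⟨hv, h2⟩, rfl⟩
          have hmem : (n + 1, v) ∈ hnewfin.toFinset :=
            (hnewfin.mem_toFinset).2 ⟨v, ⟨hv, by rintro rfl; exact hd h2⟩, rfl⟩
          exact ⟨hmem, h2, (hzero _ hmem).trans hs.symm⟩
      rw [h1, Set.ncard_image_of_injective _ (Prod.mk_right_injective _), seedCount]
      ring
    · refine Finset.sum_eq_zero fun y hy => if_neg ?_
      rw [hzero y hy]
      exact fun h => hs h.2.symm
  -- Among the old vertices only the latch changes its status, so the sum of differences collapses
  -- to one term.
  have hold : ∑ y ∈ (finite_network_vertexSet hG hq n).toFinset,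
      ((if deg G y.2 = d ∧ timesLatched (latches q) (n + 1) y = s then (1 : ℝ) else 0)
        - if deg G y.2 = d ∧ timesLatched (latches q) n y = s then (1 : ℝ) else 0) =
      (if deg G (q n).1.2 = d ∧ timesLatched (latches q) n (q n).1 + 1 = s then 1 else 0)
      - (if q n ∈ colourClass G q n d s then 1 else 0) := by
    rw [Finset.sum_eq_single_of_mem (latches q n)
      ((Set.Finite.mem_toFinset _).2 (latches_mem hq n))]
    · rw [timesLatched_succ, if_pos rfl]
      simp only [colourClass, Set.mem_ofPred_eq, latches]
      congr 1
      congr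
    · intro y _ hy
      rw [timesLatched_succ, if_neg hy.symm, add_zero, sub_self]
  rw [Finset.sum_sub_distrib] at hold
  rw [degreeCount_eq_sum hG hq (n + 1), degreeCount_eq_sum hG hq n, hunion,
    Finset.sum_union hdisj, hnew]
  linarith

end Growth

/-! ### Strong law for choices uniform given the past -/

section UniformChoice

variable {Ω P : Type*} [MeasurableSpace Ω] {μ : Measure Ω}

/-- The event that the first `n` choices are those of `q`. -/
def cylinder (p : ℕ → Ω → P) (n : ℕ) (q : ℕ → P) : Set Ω := {ω | ∀ t < n, p t ω = q t}

theorem measurableSet_cylinder {p : ℕ → Ω → P} (hp : ∀ t x, MeasurableSet {ω | p t ω = x}) (n : ℕ)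
    (q : ℕ → P) : MeasurableSet (cylinder p n q) := by
  have : cylinder p n q = ⋂ t ∈ Set.Iio n, {ω | p t ω = q t} := by
    ext ω; simp [cylinder]
  rw [this]
  exact MeasurableSet.biInter (Set.to_countable _) fun t _ => hp t _

/-- The cylinders of length `n` with values in `K` are disjoint and cover almost everything. -/
theorem exists_cylinder_partition [Nonempty P] {p : ℕ → Ω → P} {K : Set P}
    (hpK : ∀ᵐ ω ∂μ, ∀ n, p n ω ∈ K) (n : ℕ) :
    ∃ Q : (Fin n → K) → ℕ → P,
      Pairwise (Function.onFun Disjoint fun a => cylinder p n (Q a)) ∧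
      ∀ᵐ ω ∂μ, ω ∈ ⋃ a, cylinder p n (Q a) := by
  obtain ⟨x₀⟩ := ‹Nonempty P›
  refine ⟨fun a t => if h : t < n then (a ⟨t, h⟩ : P) else x₀, ?_, ?_⟩
  · intro a b hab
    rw [Function.onFun, Set.disjoint_left]
    intro ω ha hb
    refine hab (funext fun t => Subtype.ext ?_)
    have h1 := ha t t.2
    have h2 := hb t t.2
    simp only [t.2, dif_pos] at h1 h2
    exact h1.symm.trans h2
  · filter_upwards [hpK] with ω hω
    refine Set.mem_iUnion.2 ⟨fun t => ⟨p t ω, hω t⟩, fun t ht => ?_⟩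
    simp only [dif_pos ht]

/-- A function of finitely many choices from a countable set is measurable. -/
theorem aestronglyMeasurable_of_constant_on_cylinders [Nonempty P] {p : ℕ → Ω → P} {K : Set P}
    (hK : K.Countable) (hpK : ∀ᵐ ω ∂μ, ∀ n, p n ω ∈ K)
    (hp : ∀ t x, MeasurableSet {ω | p t ω = x}) {n : ℕ} {f : Ω → ℝ}
    (hf : ∀ ω ω', (∀ t < n, p t ω = p t ω') → f ω = f ω') : AEStronglyMeasurable f μ := by
  -- `P` may be uncountable; countability of `K` leaves countably many cylinders of length `n`, on
  -- each of which `f` is constant.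
  have := hK.to_subtype
  obtain ⟨Q, -, hcov⟩ := exists_cylinder_partition hpK n
  have hrestrict : μ.restrict (⋃ a, cylinder p n (Q a)) = μ := Measure.restrict_eq_self_of_ae_mem hcov
  rw [← hrestrict]
  refine AEStronglyMeasurable.iUnion fun a => ?_
  rcases (cylinder p n (Q a)).eq_empty_or_nonempty with h | ⟨ω₀, hω₀⟩
  · rw [h, Measure.restrict_empty]
    exact aestronglyMeasurable_zero_measure f
  · refine (aestronglyMeasurable_const (b := f ω₀)).congr ?_
    filter_upwards [ae_restrict_mem (measurableSet_cylinder hp n (Q a))] with ω hω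
    exact hf ω₀ ω fun t ht => (hω₀ t ht).trans (hω t ht).symm

open Classical in
/-- The centred indicator of the event that the `n`-th choice, uniform over `A`, falls in `C`. -/
noncomputable def centredIndicator (A C : (ℕ → P) → ℕ → Set P) (n : ℕ) (q : ℕ → P) : ℝ :=
  (if q n ∈ C q n then 1 else 0) - ((C q n ∩ A q n).ncard : ℝ) / (A q n).ncard

theorem abs_centredIndicator_le {A C : (ℕ → P) → ℕ → Set P} {n : ℕ} {q : ℕ → P} :
    |centredIndicator A C n q| ≤ 1 := by
  have h0 : 0 ≤ ((C q n ∩ A q n).ncard : ℝ) / (A q n).ncard := by positivity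
  have h1 : ((C q n ∩ A q n).ncard : ℝ) / (A q n).ncard ≤ 1 := by
    rcases (A q n).finite_or_infinite with h | h
    · refine div_le_one_of_le₀ ?_ (Nat.cast_nonneg _)
      exact_mod_cast Set.ncard_le_ncard Set.inter_subset_right h
    · simp [h.ncard]
  unfold centredIndicator
  rw [abs_le]
  split_ifs <;> constructor <;> linarith

theorem centredIndicator_congr {A C : (ℕ → P) → ℕ → Set P}
    (hA : ∀ q q' n, (∀ t < n, q t = q' t) → A q n = A q' n)
    (hC : ∀ q q' n, (∀ t < n, q t = q' t) → C q n = C q' n) {n : ℕ} {q q' : ℕ → P}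
    (h : ∀ t < n + 1, q t = q' t) : centredIndicator A C n q = centredIndicator A C n q' := by
  have h' : ∀ t < n, q t = q' t := fun t ht => h t (by omega)
  unfold centredIndicator
  rw [hA q q' n h', hC q q' n h', h n (by omega)]

variable [IsProbabilityMeasure μ]

/-- Conditionally on a history, the centred indicator has mean zero. -/
theorem setIntegral_cylinder_centredIndicator {p : ℕ → Ω → P}
    (hp : ∀ t x, MeasurableSet {ω | p t ω = x}) {A C : (ℕ → P) → ℕ → Set P}
    (hA : ∀ q q' n, (∀ t < n, q t = q' t) → A q n = A q' n)
    (hC : ∀ q q' n, (∀ t < n, q t = q' t) → C q n = C q' n)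
    (hpA : ∀ᵐ ω ∂μ, ∀ n, p n ω ∈ A (fun t => p t ω) n)
    (huniform : ∀ (n : ℕ) (q : ℕ → P), q n ∈ A q n →
      μ (cylinder p (n + 1) q) = μ (cylinder p n q) / ((A q n).ncard : ENNReal))
    {n : ℕ} {q : ℕ → P} (hfin : (A q n).Finite) :
    ∫ ω in cylinder p n q, centredIndicator A C n (fun t => p t ω) ∂μ = 0 := by
  classical
  set E := cylinder p n q with hE
  have hEm : MeasurableSet E := measurableSet_cylinder hp n q
  have hBfin : (C q n ∩ A q n).Finite := hfin.subset Set.inter_subset_right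
  set B := hBfin.toFinset with hB
  set F : Set Ω := ⋃ x ∈ B, {ω | p n ω = x} with hF
  have hFm : MeasurableSet F := Finset.measurableSet_biUnion _ fun x _ => hp n x
  set ρ : ℝ := ((C q n ∩ A q n).ncard : ℝ) / (A q n).ncard with hρ
  have hcongr : ∫ ω in E, centredIndicator A C n (fun t => p t ω) ∂μ =
      ∫ ω in E, (F.indicator 1 ω - ρ) ∂μ := by
    refine integral_congr_ae ?_
    filter_upwards [ae_restrict_of_ae hpA, ae_restrict_mem hEm] with ω hω hωE
    have h1 := hA (fun t => p t ω) q n hωE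
    have h2 := hC (fun t => p t ω) q n hωE
    have h3 : ω ∈ F ↔ p n ω ∈ C q n := by
      have := hω n
      rw [h1] at this
      simp [hF, hB, this]
    simp only [centredIndicator, h1, h2, Set.indicator_apply, h3, Pi.one_apply, hρ]
  have hpoint : ∀ x ∈ B, μ.real (E ∩ {ω | p n ω = x}) = μ.real E / (A q n).ncard := by
    intro x hx
    have hxA : x ∈ A q n := ((hBfin.mem_toFinset).1 hx).2
    -- Overwriting `q` at time `n` keeps the history, hence `A`, and lets `huniform` give the
    -- probability of choosing `x` next.
    have hupd : ∀ t < n, Function.update q n x t = q t := fun t ht =>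
      Function.update_of_ne ht.ne _ _
    have hAu : A (Function.update q n x) n = A q n := hA _ _ n hupd
    have h := huniform n (Function.update q n x) (by rw [hAu]; simpa using hxA)
    have h1 : cylinder p (n + 1) (Function.update q n x) = E ∩ {ω | p n ω = x} := by
      ext ω
      simp only [cylinder, hE, Set.mem_inter_iff, Set.mem_ofPred_eq]
      constructor
      · intro hω
        refine ⟨fun t ht => ?_, ?_⟩
        · rw [hω t (by omega), hupd t ht]
        · simpa using hω n (by omega)
      · rintro ⟨hω, hx⟩ t ht
        rcases Nat.lt_succ_iff_lt_or_eq.1 ht with h | rfl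
        · rw [hω t h, hupd t h]
        · simpa using hx
    have h2 : cylinder p n (Function.update q n x) = E := by
      ext ω
      exact forall₂_congr fun t ht => by rw [hupd t ht]
    rw [h1, h2, hAu] at h
    rw [measureReal_def, h, ENNReal.toReal_div, measureReal_def, ENNReal.toReal_natCast]
  have hEF : μ.real (E ∩ F) = ρ * μ.real E := by
    have h1 : E ∩ F = ⋃ x ∈ B, (E ∩ {ω | p n ω = x}) := by
      simp only [hF, Set.inter_iUnion]
    rw [h1, measureReal_biUnion_finset]
    · rw [Finset.sum_congr rfl hpoint, Finset.sum_const, nsmul_eq_mul, hρ,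
        Set.ncard_eq_toFinset_card _ hBfin]
      ring
    · intro x _ y _ hxy
      rw [Function.onFun, Set.disjoint_left]
      rintro ω ⟨-, hx⟩ ⟨-, hy⟩
      exact hxy (hx.symm.trans hy)
    · exact fun x _ => hEm.inter (hp n x)
  have hone : Integrable (F.indicator (1 : Ω → ℝ)) (μ.restrict E) :=
    Integrable.indicator (integrable_const 1) hFm
  rw [hcongr, integral_sub hone (integrable_const ρ),
    integral_indicator_one hFm, integral_const, measureReal_restrict_apply hFm,
    measureReal_restrict_apply_univ, Set.inter_comm, hEF, smul_eq_mul]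
  ring

/-- Strong law for choices that are uniform given the past: the frequency of a predictable event
is asymptotically the average of its conditional probabilities. -/
theorem ae_tendsto_average_centredIndicator [Nonempty P] {p : ℕ → Ω → P} {K : Set P}
    (hK : K.Countable) (hpK : ∀ᵐ ω ∂μ, ∀ n, p n ω ∈ K) (hp : ∀ t x, MeasurableSet {ω | p t ω = x})
    {A C : (ℕ → P) → ℕ → Set P}
    (hA : ∀ q q' n, (∀ t < n, q t = q' t) → A q n = A q' n)
    (hC : ∀ q q' n, (∀ t < n, q t = q' t) → C q n = C q' n)
    (hpA : ∀ᵐ ω ∂μ, ∀ n, p n ω ∈ A (fun t => p t ω) n)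
    (hfin : ∀ q, (∀ n, q n ∈ A q n) → ∀ n, (A q n).Finite)
    (huniform : ∀ (n : ℕ) (q : ℕ → P), q n ∈ A q n →
      μ (cylinder p (n + 1) q) = μ (cylinder p n q) / ((A q n).ncard : ENNReal)) :
    ∀ᵐ ω ∂μ, Tendsto (fun n : ℕ =>
      (∑ t ∈ Finset.range n, centredIndicator A C t (fun u => p u ω)) / n) atTop (𝓝 0) := by
  have hmeas : ∀ n, AEStronglyMeasurable
      (fun ω => centredIndicator A C n (fun u => p u ω)) μ := fun n =>
    aestronglyMeasurable_of_constant_on_cylinders hK hpK hp (n := n + 1)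
      fun ω ω' h => centredIndicator_congr hA hC h
  refine ae_tendsto_average_of_orthogonal hmeas (fun n ω => abs_centredIndicator_le)
    fun s t hst => ?_
  have := hK.to_subtype
  obtain ⟨Q, hdisj, hcov⟩ := exists_cylinder_partition hpK t
  have hint : Integrable (fun ω => centredIndicator A C s (fun u => p u ω) *
      centredIndicator A C t (fun u => p u ω)) μ := by
    refine Integrable.of_bound ((hmeas s).mul (hmeas t)) 1 (ae_of_all _ fun ω => ?_)
    rw [norm_mul, Real.norm_eq_abs, Real.norm_eq_abs]
    exact mul_le_one₀ abs_centredIndicator_le (abs_nonneg _) abs_centredIndicator_le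
  -- Condition on the first `t` choices: as `s < t`, the earlier factor is constant on each cylinder
  -- and the later one integrates to zero.
  rw [← Measure.restrict_eq_self_of_ae_mem hcov,
    integral_iUnion (fun a => measurableSet_cylinder hp t (Q a)) hdisj hint.integrableOn]
  refine (tsum_congr fun a => ?_).trans tsum_zero
  -- Finiteness of `A` is known only along admissible paths. A cylinder containing one borrows it
  -- from there; any other cylinder is null.
  by_cases hgood : ∃ ω₀ ∈ cylinder p t (Q a), ∀ n, p n ω₀ ∈ A (fun u => p u ω₀) n
  · obtain ⟨ω₀, hω₀, hgood⟩ := hgood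
    have h1 : A (fun u => p u ω₀) t = A (Q a) t := hA _ _ t hω₀
    have hf : (A (Q a) t).Finite := h1 ▸ hfin _ hgood t
    rw [setIntegral_congr_fun (measurableSet_cylinder hp t (Q a))
      (g := fun ω => centredIndicator A C s (fun u => p u ω₀) *
        centredIndicator A C t (fun u => p u ω)), integral_const_mul,
      setIntegral_cylinder_centredIndicator hp hA hC hpA huniform hf, mul_zero]
    intro ω hω
    simp only
    rw [centredIndicator_congr (q := fun u => p u ω) hA hC fun u hu =>
      (hω u (by omega)).trans (hω₀ u (by omega)).symm]
  · refine setIntegral_measure_zero _ (measure_mono_null (fun ω hω => ?_) (ae_iff.1 hpA))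
    exact fun h => hgood ⟨ω, hω, h⟩

end UniformChoice

/-! ### Recursion for the limit vector -/

theorem fallingFactorial_succ (x : ℝ) (r : ℕ) :
    fallingFactorial x (r + 1) = fallingFactorial x r * (x - r) := Finset.prod_range_succ _ _

section Limit

variable {m τ₀ k : ℕ} {c : Fin k → ℕ} {i : Fin k}

theorem fallingFactorial_ne_zero (hα : 0 < (m : ℝ) * τ₀ - m - 1) {s : ℕ} (hs : s < m) :
    fallingFactorial ((m : ℝ) * τ₀ - 2) s ≠ 0 := by
  refine Finset.prod_ne_zero_iff.2 fun l hl => ?_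
  have h : ((l + 2 : ℕ) : ℝ) ≤ m := by
    have := Finset.mem_range.1 hl
    exact_mod_cast (by omega : l + 2 ≤ m)
  push_cast at h
  exact (by linarith : (0 : ℝ) < (m : ℝ) * τ₀ - 2 - l).ne'

theorem limitVector_zero (hm : 1 ≤ m) (hα : 0 < (m : ℝ) * τ₀ - m - 1) (j : Fin k) :
    limitVector m τ₀ k c i 0 j = ((c j : ℝ) - if j = i then 1 else 0) *
      ((m : ℝ) * τ₀ - m - 1) / ((m : ℝ) * τ₀ - m - 1 + m) := by
  have hm' : (0 : ℝ) < m := by exact_mod_cast hm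
  have h0 : (m : ℝ) * τ₀ - m - 1 + m ≠ 0 := by linarith
  have h1 : (m : ℝ) * τ₀ - 1 ≠ 0 := by linarith
  simp only [limitVector, firstBlock, fallingFactorial, Fin.val_zero, if_pos (show 0 < m from hm),
    Finset.range_zero, Finset.prod_empty, Nat.cast_zero, sub_zero, div_one, mul_one]
  rw [show (m : ℝ) * τ₀ - m - 1 + m = (m : ℝ) * τ₀ - 1 by ring]
  field_simp

/-- This has the shape `a α / (α + r)` of the outflow lemma, with inflow slope `a = (m - s) L_s / α`
from stage `s` and `r = m - (s + 1)`. The denominator `α + r = m τ₀ - 2 - s` is the next factor of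
the falling factorial; at `s + 1 = m` there is no outflow, which accounts for the separate last
block. -/
theorem limitVector_succ (hα : 0 < (m : ℝ) * τ₀ - m - 1) (j : Fin k) {s : ℕ} (hs : s + 1 < m + 1) :
    limitVector m τ₀ k c i ⟨s + 1, hs⟩ j =
      ((m : ℝ) - s) * limitVector m τ₀ k c i ⟨s, by omega⟩ j / ((m : ℝ) * τ₀ - m - 1) *
        ((m : ℝ) * τ₀ - m - 1) / ((m : ℝ) * τ₀ - m - 1 + (m - ((s + 1 : ℕ) : ℝ))) := by
  have hsm : s < m := by omega
  have hF := fallingFactorial_ne_zero hα hsm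
  have hms : (m : ℝ) - s ≠ 0 := by
    have : (s : ℝ) < m := by exact_mod_cast hsm
    linarith
  simp only [limitVector, if_pos hsm]
  split_ifs with h
  · have hms' : (m : ℝ) - (s + 1) ≠ 0 := by
      have : ((s + 1 : ℕ) : ℝ) < m := by exact_mod_cast h
      push_cast at this
      linarith
    have hF' := fallingFactorial_ne_zero hα h
    rw [fallingFactorial_succ] at hF'
    have h2 := right_ne_zero_of_mul hF'
    rw [fallingFactorial_succ, fallingFactorial_succ]
    push_cast
    rw [show (m : ℝ) * τ₀ - m - 1 + (m - (s + 1)) = (m : ℝ) * τ₀ - 2 - s by ring]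
    field_simp
    ring
  · obtain rfl : m = s + 1 := by omega
    have hα' := hα.ne'
    push_cast at *
    rw [sub_self, add_zero, mul_div_cancel_right₀ _ hα']
    simp only [add_sub_cancel_left, add_sub_cancel_right, one_mul, div_one]
    rw [mul_assoc, mul_div_cancel_left₀ _ hα']

end Limit

/-! ### Degree counts of the seed and row sums of the urn -/

section Seed

variable {α β : Type*} {G : Graph α β} {hook : α}

theorem sum_seedCount (hG : IsSeed G hook) {k : ℕ} {d : Fin k → ℕ} (hd : StrictMono d)
    (hrange : Set.range d = deg G '' G.vertexSet) :
    ∑ j, seedCount G (d j) = G.vertexSet.ncard := by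
  classical
  have hmap : ∀ v ∈ hG.finite_vertexSet.toFinset, deg G v ∈ Finset.univ.image d := by
    intro v hv
    have : deg G v ∈ Set.range d := hrange ▸ ⟨v, (hG.finite_vertexSet.mem_toFinset).1 hv, rfl⟩
    simpa using this
  rw [Set.ncard_eq_toFinset_card _ hG.finite_vertexSet,
    Finset.card_eq_sum_card_fiberwise hmap, Finset.sum_image hd.injective.injOn]
  refine Finset.sum_congr rfl fun j _ => ?_
  rw [seedCount, ← Set.ncard_coe_finset]
  simp [Set.ofPred_and]

/-- Every row of the replacement matrix has sum `m τ₀ - m - 1`. -/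
theorem replacementMatrix_mulVec_one {m k : ℕ} {c : Fin k → ℕ} {i : Fin k} {τ₀ : ℕ}
    (hc : ∑ j, c j = τ₀) :
    (replacementMatrix m k c i).mulVec 1 = fun _ => (m : ℝ) * τ₀ - m - 1 := by
  have hc' : ∑ j, (c j : ℝ) = τ₀ := by exact_mod_cast hc
  ext ⟨a, j⟩
  have hm : 0 < m := a.pos
  simp only [Matrix.mulVec, dotProduct, Pi.one_apply, mul_one, replacementMatrix, Matrix.of_apply,
    Finset.sum_add_distrib, Finset.sum_sub_distrib, Finset.sum_ite_eq', Finset.mem_univ, if_true]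
  have h1 : ∑ b : Fin m × Fin k, (if (b.1 : ℕ) = 0 then
      (m : ℝ) * ((c b.2 : ℝ) - if b.2 = i then 1 else 0) else 0) = m * (τ₀ - 1) := by
    rw [Fintype.sum_prod_type, Finset.sum_eq_single (⟨0, hm⟩ : Fin m)]
    · simp [← Finset.mul_sum, Finset.sum_sub_distrib, hc']
    · intro b _ hb
      have : (b : ℕ) ≠ 0 := fun h => hb (Fin.ext h)
      simp [this]
    · simp
  have h2 : ∑ b : Fin m × Fin k, (if (b.1 : ℕ) = a + 1 ∧ b.2 = j then (m : ℝ) - a - 1 else 0) =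
      m - a - 1 := by
    by_cases ha : (a : ℕ) + 1 < m
    · rw [Finset.sum_eq_single (⟨a + 1, ha⟩, j)]
      · simp
      · rintro ⟨b, l⟩ _ hb
        refine if_neg fun h => hb ?_
        exact Prod.ext (Fin.ext h.1) h.2
      · simp
    -- In the last row block no colour of stage `m` exists, but its coefficient `m - a - 1` vanishes
    -- anyway.
    · have h3 : (m : ℝ) = a + 1 := by exact_mod_cast (by omega : m = a + 1)
      rw [h3]
      simp
  rw [h1, h2]
  ring

end Seed

/-! ### Limits along a typical path -/

section Path

variable {α β : Type*} {G : Graph α β} {hook : α} {m : ℕ} {q : ℕ → Position α m}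

/-- On a path along which the colour frequencies follow their conditional probabilities,
the scaled degree counts converge. -/
theorem tendsto_degreeCount_div (hG : IsSeed G hook) (hm : 1 ≤ m)
    (hq : ∀ n, q n ∈ available G hook q n)
    (hα : 0 < (m : ℝ) * G.vertexSet.ncard - m - 1) {k : ℕ} {d : Fin k → ℕ} (hd : StrictMono d)
    {i : Fin k} (hi : d i = deg G hook) (j : Fin k)
    (hlim : ∀ s, Tendsto (fun n : ℕ => (∑ t ∈ Finset.range n, centredIndicator
      (fun q n => available G hook q n) (fun q n => colourClass G q n (d j) s) t q) / n)
      atTop (𝓝 0)) (s : ℕ) (hs : s < m + 1) :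
    Tendsto (fun n : ℕ => (degreeCount G hook (latches q) n (d j) s : ℝ) / n) atTop
      (𝓝 (limitVector m G.vertexSet.ncard k (fun j => seedCount G (d j)) i ⟨s, hs⟩ j)) := by
  classical
  set τ₀ := G.vertexSet.ncard
  set a : ℝ := (m : ℝ) * τ₀ - m - 1 with ha
  set X : ℕ → ℕ → ℝ := fun s n => degreeCount G hook (latches q) n (d j) s with hX
  set S : ℕ → ℕ → ℝ := fun s n => ∑ t ∈ Finset.range n,
    if q t ∈ colourClass G q t (d j) s then 1 else 0 with hS
  set b : ℝ := (seedCount G (d j) : ℝ) - if j = i then 1 else 0 with hb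
  have hX0 : ∀ n : ℕ, X 0 n + S 0 n = X 0 0 + b * n := by
    intro n
    induction n with
    | zero => simp [hS]
    | succ n ih =>
      have h1 : (deg G hook = d j) = (j = i) := by
        rw [← hi, hd.injective.eq_iff, eq_comm (a := i)]
      have h2 := degreeCount_succ hG hq n (d j) 0
      simp only [if_pos, h1, Nat.add_eq_zero_iff, one_ne_zero, and_false, if_false, add_zero] at h2
      have h3 : S 0 (n + 1) = S 0 n + _ := Finset.sum_range_succ _ _
      simp only [hX] at ih ⊢
      rw [h2, h3]
      push_cast
      linarith
  have hXs : ∀ s n : ℕ, X (s + 1) n + S (s + 1) n = X (s + 1) 0 + S s n := by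
    intro s n
    induction n with
    | zero => simp [hS]
    | succ n ih =>
      have h2 := degreeCount_succ hG hq n (d j) (s + 1)
      simp only [Nat.add_eq_zero_iff, one_ne_zero, and_false, if_false, add_zero,
        Nat.add_right_cancel_iff] at h2
      have h3 : S (s + 1) (n + 1) = S (s + 1) n + _ := Finset.sum_range_succ _ _
      have h4 : S s (n + 1) = S s n +
          if deg G (q n).1.2 = d j ∧ timesLatched (latches q) n (q n).1 = s then 1 else 0 := by
        rw [hS]
        simp only [Finset.sum_range_succ, colourClass, Set.mem_ofPred_eq]
        congr
      simp only [hX] at ih ⊢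
      rw [h2, h3, h4]
      linarith
  have hout : ∀ s : ℕ, Tendsto (fun n : ℕ => (S s n - ∑ t ∈ Finset.range n,
      ((m : ℝ) - s) * X s t / (m * τ₀ + a * t)) / n) atTop (𝓝 0) := by
    intro s
    refine (hlim s).congr fun n => ?_
    rw [hS, ← Finset.sum_sub_distrib]
    congr 1
    refine Finset.sum_congr rfl fun t _ => ?_
    rw [centredIndicator, ncard_colourClass_inter_available hG hq, ncard_available hG hq]
  have hconst : ∀ x : ℝ, Tendsto (fun n : ℕ => x / (n : ℝ)) atTop (𝓝 0) := fun x =>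
    tendsto_const_div_atTop_nhds_zero_nat x
  have hτ : (1 : ℝ) ≤ τ₀ := by
    have : 0 < τ₀ := (Set.ncard_pos hG.finite_vertexSet).2 ⟨hook, hG.hook_mem⟩
    exact_mod_cast this
  have hm' : (0 : ℝ) < m := by exact_mod_cast hm
  have hmτ : (m : ℝ) ≤ m * τ₀ := le_mul_of_one_le_right hm'.le hτ
  have key : ∀ {s : ℕ} {y : ℝ}, s ≤ m → Tendsto (fun n : ℕ => (X s n + S s n) / n) atTop (𝓝 y) →
      Tendsto (fun n : ℕ => X s n / n) atTop (𝓝 (y * a / (a + (m - s)))) ∧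
      Tendsto (fun n : ℕ => S s n / n) atTop
        (𝓝 (((m : ℝ) - s) * (y * a / (a + (m - s))) / a)) := by
    intro s y hs h
    have hs' : (s : ℝ) ≤ m := by exact_mod_cast hs
    have hr : (0 : ℝ) ≤ m - s := sub_nonneg.2 hs'
    have hXlim := tendsto_div_of_proportional_outflow hα (hm'.trans_le hmτ) hr
      (by have := s.cast_nonneg (α := ℝ); linarith) h (hout s)
    refine ⟨hXlim, ?_⟩
    have hval : y - y * a / (a + (m - s)) = ((m : ℝ) - s) * (y * a / (a + (m - s))) / a := by
      have : a + (m - s) ≠ 0 := by linarith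
      have := hα.ne'
      field_simp
      ring
    rw [← hval]
    refine (h.sub hXlim).congr fun n => ?_
    ring
  set L := limitVector m τ₀ k (fun j => seedCount G (d j)) i with hLdef
  -- The outflow must be carried through the induction, being the inflow of the next stage.
  suffices h : Tendsto (fun n : ℕ => X s n / n) atTop (𝓝 (L ⟨s, hs⟩ j)) ∧
      Tendsto (fun n : ℕ => S s n / n) atTop (𝓝 (((m : ℝ) - s) * L ⟨s, hs⟩ j / a)) from h.1
  induction s with
  | zero =>
    have h := key (s := 0) (y := b) (Nat.zero_le m) ?_
    · have hL := limitVector_zero (c := fun j => seedCount G (d j)) (i := i) hm hα j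
      rw [← hLdef, ← ha, ← hb] at hL
      rw [show (⟨0, hs⟩ : Fin (m + 1)) = 0 from rfl, hL]
      simpa only [Nat.cast_zero, sub_zero] using h
    · have h1 := (hconst (X 0 0)).add_const b
      rw [zero_add] at h1
      refine h1.congr' ?_
      filter_upwards [eventually_gt_atTop 0] with n hn
      have hn' : (n : ℝ) ≠ 0 := by exact_mod_cast hn.ne'
      rw [hX0]
      field_simp
  | succ s ih =>
    obtain ⟨-, h1⟩ := ih (by omega)
    rw [hLdef, limitVector_succ hα j hs]
    refine key (by omega) ?_
    have h2 := (hconst (X (s + 1) 0)).add h1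
    rw [zero_add] at h2
    refine h2.congr fun n => ?_
    rw [hXs, add_div]

end Path

end HookingNetwork

/-! ### The almost sure limit -/

theorem theorem1 {α β Ω : Type*} [MeasurableSpace Ω] (μ : Measure Ω) [IsProbabilityMeasure μ]
    (G : Graph α β) (hook : α) (hG : HookingNetwork.IsSeed G hook)
    (m : ℕ) (hm : 1 ≤ m)
    (k : ℕ) (d : Fin k → ℕ) (hd : StrictMono d)
    (hrange : Set.range d = HookingNetwork.deg G '' G.vertexSet)
    (i : Fin k) (hi : d i = HookingNetwork.deg G hook)
    (hinv : IsUnit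
      (HookingNetwork.replacementMatrix m k (fun j => HookingNetwork.seedCount G (d j)) i).transpose)
    (p : ℕ → Ω → HookingNetwork.Position α m)
    (hp : HookingNetwork.IsUniformGrowth G hook m μ p) :
    ∀ᵐ ω ∂μ, Tendsto
      (fun n : ℕ => fun (s : Fin (m + 1)) (j : Fin k) =>
        (HookingNetwork.degreeCount G hook (HookingNetwork.latches fun t => p t ω) n (d j) s : ℝ)
          / (n : ℝ))
      atTop
      (𝓝 (HookingNetwork.limitVector m G.vertexSet.ncard k
        (fun j => HookingNetwork.seedCount G (d j)) i)) := by
  classical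
  -- With zero row sums the all-ones vector would lie in the kernel of the replacement matrix.
  have hαne : (m : ℝ) * G.vertexSet.ncard - m - 1 ≠ 0 := by
    intro h0
    have hrow := HookingNetwork.replacementMatrix_mulVec_one (m := m) (i := i)
      (HookingNetwork.sum_seedCount hG hd hrange)
    rw [h0] at hrow
    have hinj := Matrix.mulVec_injective_iff_isUnit.2 ((Matrix.isUnit_transpose _).1 hinv)
    have h1 := congr_fun (hinj (hrow.trans (Matrix.mulVec_zero (HookingNetwork.replacementMatrix m k
      (fun j => HookingNetwork.seedCount G (d j)) i)).symm)) (⟨0, hm⟩, i)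
    exact one_ne_zero h1
  obtain ⟨hmeas, hmem, hunif⟩ := hp
  have : Nonempty (HookingNetwork.Position α m) := ⟨((0, hook), ⟨0, hm⟩)⟩
  -- The vertex type may be uncountable, but the choices only involve the finitely many vertices of
  -- the seed.
  set K : Set (HookingNetwork.Position α m) := (Set.univ ×ˢ G.vertexSet) ×ˢ Set.univ with hKdef
  have hK : K.Countable :=
    (Set.countable_univ.prod hG.finite_vertexSet.countable).prod Set.countable_univ
  have hpK : ∀ᵐ ω ∂μ, ∀ n, p n ω ∈ K := by
    filter_upwards [hmem] with ω hω n
    exact ⟨⟨trivial, (HookingNetwork.network_vertexSet_subset hω n (hω n).1).2⟩, trivial⟩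
  have hlaw : ∀ᵐ ω ∂μ, ∀ (j : Fin k) (s : ℕ), Tendsto (fun n : ℕ =>
      (∑ t ∈ Finset.range n, HookingNetwork.centredIndicator
        (fun q n => HookingNetwork.available G hook q n)
        (fun q n => HookingNetwork.colourClass G q n (d j) s) t (fun u => p u ω)) / n)
      atTop (𝓝 0) := by
    refine ae_all_iff.2 fun j => ae_all_iff.2 fun s => ?_
    refine HookingNetwork.ae_tendsto_average_centredIndicator hK hpK hmeas
      (fun q q' n h => HookingNetwork.available_congr h)
      (fun q q' n h => HookingNetwork.colourClass_congr h _ _) hmem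
      (fun q hq n => HookingNetwork.finite_available hG hq n) fun n q hq => ?_
    rw [← show {ω | ∀ t ≤ n, p t ω = q t} = HookingNetwork.cylinder p (n + 1) q by
      simp only [HookingNetwork.cylinder, Nat.lt_succ_iff]]
    exact hunif n q hq
  filter_upwards [hmem, hlaw] with ω hω hlim
  have hα : 0 < (m : ℝ) * G.vertexSet.ncard - m - 1 := by
    refine lt_of_le_of_ne ?_ hαne.symm
    by_contra! hneg
    have hle : (m : ℝ) * G.vertexSet.ncard - m - 1 ≤ -1 := by
      have h1 : m * G.vertexSet.ncard < m + 1 := by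
        have : (m : ℝ) * G.vertexSet.ncard < m + 1 := by linarith
        exact_mod_cast this
      have h2 : ((m * G.vertexSet.ncard : ℕ) : ℝ) ≤ m := by
        exact_mod_cast Nat.lt_succ_iff.1 h1
      push_cast at h2
      linarith
    -- By integrality a negative slope is at most `-1`, so no position is left at age `m τ₀`,
    -- although the path still makes a choice there.
    set n := m * G.vertexSet.ncard with hn
    have h1 := HookingNetwork.ncard_available hG hω n
    have h2 : 0 < (HookingNetwork.available G hook (fun t => p t ω) n).ncard :=
      (Set.ncard_pos (HookingNetwork.finite_available hG hω n)).2 ⟨_, hω n⟩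
    have h3 : (0 : ℝ) < (HookingNetwork.available G hook (fun t => p t ω) n).ncard := by
      exact_mod_cast h2
    rw [h1] at h3
    have h4 := mul_le_mul_of_nonneg_right hle (n.cast_nonneg (α := ℝ))
    have h5 : (n : ℝ) = m * G.vertexSet.ncard := by rw [hn]; push_cast; rfl
    linarith
  exact tendsto_pi_nhds.2 fun s => tendsto_pi_nhds.2 fun j =>
    HookingNetwork.tendsto_degreeCount_div hG hm hω hα hd hi j (hlim j) s s.2
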